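/- A rectangle has a width and a height in $(0,1]$. For a finite list $L$ of rectangles, with repetitions allowed, let $OPT(L)$ be the minimum height $H\ge 0$ such that the rectangles of $L$ can be placed in $[0,1]\times[0,H]$ with sides parallel to the axes, without rotation, and with pairwise disjoint interiors. For $r\ge 1$, a list $L$ is called $r$-homogenous to a list $L'$ if, for every width $w$, $$\sum_{R'\in L',\,w(R')=w} h(R')\ \le\ \sum_{R\in L,\,w(R)=w} h(R)\ \le\ r\cdot\sum_{R'\in L',\,w(R')=w} h(R'),$$ where $w(R)$ and $h(R)$ denote the width and the height of $R$. Theorem. There is an absolute constant $C$ such that for all finite lists $L$ and $L'$, all real $r\ge 1$ for which $L$ is $r$-homogenous to $L'$, and every $\varepsilon>0$, $$OPT(L)\ \le\ r(1+\varepsilon)\,OPT(L') + C\max\{1,\varepsilon^{-2}\}.$$ In particular, for $0<\varepsilon\le 1$ the additive term is $C\varepsilon^{-2}$, that is, $O(\varepsilon^{-2})$ as $\varepsilon\to 0$. -/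

import Mathlib

noncomputable section

namespace StripPacking

/-- A rectangle whose width and height are positive and at most one. -/
structure Rect where
  width : ℝ
  height : ℝ
  width_pos : 0 < width
  width_le_one : width ≤ 1
  height_pos : 0 < height
  height_le_one : height ≤ 1

/-- The open region occupied by the rectangle `R` (not rotated) when its lower left corner is
placed at `p`. -/
def Rect.openRegion (R : Rect) (p : ℝ × ℝ) : Set (ℝ × ℝ) :=
  Set.Ioo p.1 (p.1 + R.width) ×ˢ Set.Ioo p.2 (p.2 + R.height)

/-- `pos` gives the lower left corners of a packing of the list `L` into the part
`[0, 1] × [0, H]` of the vertical strip of width one: every rectangle lies inside, and no two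
rectangles overlap (touching boundaries are allowed). -/
structure IsPacking (L : List Rect) (H : ℝ) (pos : Fin L.length → ℝ × ℝ) : Prop where
  left : ∀ i, 0 ≤ (pos i).1
  right : ∀ i, (pos i).1 + (L.get i).width ≤ 1
  bottom : ∀ i, 0 ≤ (pos i).2
  top : ∀ i, (pos i).2 + (L.get i).height ≤ H
  disjoint : ∀ i j, i ≠ j →
    Disjoint ((L.get i).openRegion (pos i)) ((L.get j).openRegion (pos j))

/-- The heights `H` of strips into which `L` can be packed. -/
def feasibleHeights (L : List Rect) : Set ℝ :=
  {H : ℝ | 0 ≤ H ∧ ∃ pos : Fin L.length → ℝ × ℝ, IsPacking L H pos}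

/-- The optimal strip packing height of `L`. -/
def OPT (L : List Rect) : ℝ := sInf (feasibleHeights L)

/-- Stacking all the rectangles shows that some height is feasible. -/
theorem feasibleHeights_nonempty (L : List Rect) : (feasibleHeights L).Nonempty := by
  refine ⟨L.length, by positivity, fun i => (0, (i : ℕ)), ?_⟩
  constructor
  · intro i; simp
  · intro i; simpa using (L.get i).width_le_one
  · intro i; simp
  · intro i
    have h1 := (L.get i).height_le_one
    have h2 : ((i : ℕ) : ℝ) + 1 ≤ L.length := by exact_mod_cast i.isLt
    show ((i : ℕ) : ℝ) + (L.get i).height ≤ L.length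
    linarith
  · intro i j hij
    rw [Set.disjoint_left]
    rintro p ⟨-, hi1, hi2⟩ ⟨-, hj1, hj2⟩
    have h1 := (L.get i).height_le_one
    have h2 := (L.get j).height_le_one
    dsimp only at hi1 hi2 hj1 hj2
    rcases lt_or_gt_of_ne (fun h => hij (Fin.ext h) : (i : ℕ) ≠ j) with h | h
    · have h3 : ((i : ℕ) : ℝ) + 1 ≤ (j : ℕ) := by exact_mod_cast h
      linarith
    · have h3 : ((j : ℕ) : ℝ) + 1 ≤ (i : ℕ) := by exact_mod_cast h
      linarith

theorem feasibleHeights_bddBelow (L : List Rect) : BddBelow (feasibleHeights L) :=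
  ⟨0, fun _ h => h.1⟩

/-- The sum of the heights of the rectangles of `L` of width `w`, with multiplicity. -/
def heightOfWidth (L : List Rect) (w : ℝ) : ℝ :=
  ((L.filter (fun R => R.width = w)).map Rect.height).sum

/-- `L` is `r`-homogenous to `L'`, where `r ≥ 1`. The widths which occur in neither list need not
be excluded, as both sums are zero for them. -/
def IsHomogenous (r : ℝ) (L L' : List Rect) : Prop :=
  1 ≤ r ∧ ∀ w : ℝ,
    heightOfWidth L' w ≤ heightOfWidth L w ∧ heightOfWidth L w ≤ r * heightOfWidth L' w

end StripPacking

end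

/-!
The proof follows Kenyon and Rémila's asymptotic scheme for strip packing. Fix a packing of `L'` of
height `H` and put `δ = min 1 ε / 4`, `m = ⌈1 / δ ^ 2⌉`.

Each horizontal line through the packing meets a *configuration*, a set of rectangles of total width
at most one. Averaging over all lines exhibits the vector of any `k` weighted heights
`∑ f (width) * height` of `L'` as a convex combination of the vectors of configurations, and by
Carathéodory's theorem `k + 1` of them suffice (`IsPacking.exists_configurations`). The weighted
heights to be preserved are the area of the rectangles wider than `δ` and, for `m` thresholds `t`,
the total height of the rectangles of width at least `t`. The thresholds are chosen for `L`
(`exists_thresholds`): between consecutive ones lies at most an `m`-th of the total height `A` of the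
wide rectangles of `L`. As `A * δ` is at most the area `r * H`, this is at most `δ * (r * H)`.

Stretched by `r`, these `m + 2` configurations, together with one column of width one and height
`A / m`, offer for each width at least as much room as `L` needs, since homogeneity gives
`∑ f (width) * height` over `L` at most `r` times that over `L'`. Hence a greedy filling of the
columns in order of width places all wide rectangles, overshooting each column by at most one
(`exists_columns`). The narrow rectangles are shelved beside the columns by decreasing height
(`exists_shelves_boxes`); by comparison of areas, at most `δ * (r * H)` of their area does not fit
there, and it is shelved on top. The total height is `r * H * (1 + O(δ)) + m + O(1)`
(`IsHomogenous.OPT_le`).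
-/

noncomputable section

namespace StripPacking

/-! ### Packings into a box -/

/-- The multiset `M` can be placed in `[0, W] × [0, H]` without overlaps. A placement is a list of
rectangles with their lower left corners. -/
def FitsIn (M : Multiset Rect) (W H : ℝ) : Prop :=
  ∃ P : List (Rect × (ℝ × ℝ)), ((P.map Prod.fst : List Rect) : Multiset Rect) = M ∧
    (∀ q ∈ P, 0 ≤ q.2.1 ∧ q.2.1 + q.1.width ≤ W ∧ 0 ≤ q.2.2 ∧ q.2.2 + q.1.height ≤ H) ∧
    P.Pairwise fun a b => Disjoint (a.1.openRegion a.2) (b.1.openRegion b.2)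

theorem fitsIn_zero (W H : ℝ) : FitsIn 0 W H := ⟨[], by simp, by simp, by simp⟩

theorem FitsIn.mono {M : Multiset Rect} {W W' H H' : ℝ} (h : FitsIn M W H) (hW : W ≤ W')
    (hH : H ≤ H') : FitsIn M W' H' := by
  obtain ⟨P, h1, h2, h3⟩ := h
  refine ⟨P, h1, fun q hq => ?_, h3⟩
  obtain ⟨a, b, c, d⟩ := h2 q hq
  exact ⟨a, b.trans hW, c, d.trans hH⟩

theorem fitsIn_singleton (R : Rect) : FitsIn {R} R.width R.height :=
  ⟨[(R, (0, 0))], by simp, by simp, by simp⟩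

theorem Rect.mem_openRegion_add (R : Rect) (p v z : ℝ × ℝ) :
    z ∈ R.openRegion (p + v) ↔ z - v ∈ R.openRegion p := by
  simp only [Rect.openRegion, Set.mem_prod, Set.mem_Ioo, Prod.fst_add, Prod.snd_add, Prod.fst_sub,
    Prod.snd_sub]
  constructor <;> rintro ⟨⟨h1, h2⟩, h3, h4⟩ <;> refine ⟨⟨?_, ?_⟩, ?_, ?_⟩ <;> linarith

theorem Rect.disjoint_openRegion_add {R S : Rect} {p q : ℝ × ℝ} (v : ℝ × ℝ)
    (h : Disjoint (R.openRegion p) (S.openRegion q)) :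
    Disjoint (R.openRegion (p + v)) (S.openRegion (q + v)) := by
  rw [Set.disjoint_left] at h ⊢
  intro z hz hz'
  rw [Rect.mem_openRegion_add] at hz hz'
  exact h hz hz'

theorem FitsIn.stack {M N : Multiset Rect} {W H K : ℝ} (hM : FitsIn M W H) (hN : FitsIn N W K)
    (hH : 0 ≤ H) (hK : 0 ≤ K) : FitsIn (M + N) W (H + K) := by
  obtain ⟨P, rfl, h2, h3⟩ := hM
  obtain ⟨Q, rfl, k2, k3⟩ := hN
  refine ⟨P ++ Q.map (fun q => (q.1, q.2 + (0, H))), by simp [Function.comp_def], ?_, ?_⟩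
  · intro q hq
    rcases List.mem_append.1 hq with hq | hq
    · obtain ⟨a, b, c, d⟩ := h2 q hq
      exact ⟨a, b, c, by linarith⟩
    · obtain ⟨q', hq', rfl⟩ := List.mem_map.1 hq
      obtain ⟨a, b, c, d⟩ := k2 q' hq'
      refine ⟨?_, ?_, ?_, ?_⟩ <;> simp <;> linarith
  · rw [List.pairwise_append]
    refine ⟨h3, ?_, ?_⟩
    · rw [List.pairwise_map]
      exact k3.imp fun h => Rect.disjoint_openRegion_add _ h
    · intro a ha b hb
      obtain ⟨b', hb', rfl⟩ := List.mem_map.1 hb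
      rw [Set.disjoint_left]
      rintro z ⟨-, hz⟩ ⟨-, hz'⟩
      have h1 := (h2 a ha).2.2.2
      have h2 := (k2 b' hb').2.2.1
      simp only [Set.mem_Ioo, Prod.snd_add] at hz hz'
      linarith

theorem FitsIn.beside {M N : Multiset Rect} {V W H : ℝ} (hM : FitsIn M V H) (hN : FitsIn N W H)
    (hV : 0 ≤ V) (hW : 0 ≤ W) : FitsIn (M + N) (V + W) H := by
  obtain ⟨P, rfl, h2, h3⟩ := hM
  obtain ⟨Q, rfl, k2, k3⟩ := hN
  refine ⟨P ++ Q.map (fun q => (q.1, q.2 + (V, 0))), by simp [Function.comp_def], ?_, ?_⟩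
  · intro q hq
    rcases List.mem_append.1 hq with hq | hq
    · obtain ⟨a, b, c, d⟩ := h2 q hq
      exact ⟨a, by linarith, c, d⟩
    · obtain ⟨q', hq', rfl⟩ := List.mem_map.1 hq
      obtain ⟨a, b, c, d⟩ := k2 q' hq'
      refine ⟨?_, ?_, ?_, ?_⟩ <;> simp <;> linarith
  · rw [List.pairwise_append]
    refine ⟨h3, ?_, ?_⟩
    · rw [List.pairwise_map]
      exact k3.imp fun h => Rect.disjoint_openRegion_add _ h
    · intro a ha b hb
      obtain ⟨b', hb', rfl⟩ := List.mem_map.1 hb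
      rw [Set.disjoint_left]
      rintro z ⟨hz, -⟩ ⟨hz', -⟩
      have h1 := (h2 a ha).2.1
      have h2 := (k2 b' hb').1
      simp only [Set.mem_Ioo, Prod.fst_add] at hz hz'
      linarith

theorem sum_height_nonneg (M : Multiset Rect) : 0 ≤ (M.map Rect.height).sum :=
  Multiset.sum_nonneg fun x hx => by
    obtain ⟨R, -, rfl⟩ := Multiset.mem_map.1 hx
    exact R.height_pos.le

theorem sum_width_nonneg (M : Multiset Rect) : 0 ≤ (M.map Rect.width).sum :=
  Multiset.sum_nonneg fun x hx => by
    obtain ⟨R, -, rfl⟩ := Multiset.mem_map.1 hx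
    exact R.width_pos.le

/-- Rectangles of width at most `v`, put on top of each other. -/
theorem fitsIn_column (M : Multiset Rect) {v : ℝ} (h : ∀ R ∈ M, R.width ≤ v) :
    FitsIn M v (M.map Rect.height).sum := by
  induction M using Multiset.induction with
  | empty => exact fitsIn_zero _ _
  | cons R M ih =>
    rw [Multiset.map_cons, Multiset.sum_cons, ← Multiset.singleton_add]
    exact ((fitsIn_singleton R).mono (h R (by simp)) le_rfl).stack
      (ih fun S hS => h S (by simp [hS])) R.height_pos.le (sum_height_nonneg M)

/-- Rectangles of height at most `b`, put next to each other. -/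
theorem fitsIn_shelf (M : Multiset Rect) {b : ℝ} (h : ∀ R ∈ M, R.height ≤ b) :
    FitsIn M (M.map Rect.width).sum b := by
  induction M using Multiset.induction with
  | empty => exact fitsIn_zero _ _
  | cons R M ih =>
    rw [Multiset.map_cons, Multiset.sum_cons, ← Multiset.singleton_add]
    exact ((fitsIn_singleton R).mono le_rfl (h R (by simp))).beside
      (ih fun S hS => h S (by simp [hS])) R.width_pos.le (sum_width_nonneg M)

theorem fitsIn_sum_stack {ι : Type*} (s : Finset ι) (M : ι → Multiset Rect) (W : ℝ) (h : ι → ℝ)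
    (h0 : ∀ i ∈ s, 0 ≤ h i) (hM : ∀ i ∈ s, FitsIn (M i) W (h i)) :
    FitsIn (∑ i ∈ s, M i) W (∑ i ∈ s, h i) := by
  classical
  induction s using Finset.induction_on with
  | empty => exact fitsIn_zero _ _
  | insert a s ha ih =>
    rw [Finset.sum_insert ha, Finset.sum_insert ha]
    rw [Finset.forall_mem_insert] at h0 hM
    exact hM.1.stack (ih h0.2 hM.2) h0.1 (Finset.sum_nonneg h0.2)

theorem fitsIn_sum_beside {ι : Type*} (s : Finset ι) (M : ι → Multiset Rect) (w : ι → ℝ) (H : ℝ)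
    (h0 : ∀ i ∈ s, 0 ≤ w i) (hM : ∀ i ∈ s, FitsIn (M i) (w i) H) :
    FitsIn (∑ i ∈ s, M i) (∑ i ∈ s, w i) H := by
  classical
  induction s using Finset.induction_on with
  | empty => exact fitsIn_zero _ _
  | insert a s ha ih =>
    rw [Finset.sum_insert ha, Finset.sum_insert ha]
    rw [Finset.forall_mem_insert] at h0 hM
    exact hM.1.beside (ih h0.2 hM.2) h0.1 (Finset.sum_nonneg h0.2)

/-- A permutation of the image of a list is the image of a permutation of the list. -/
theorem exists_perm_map_eq {α β : Type*} (f : α → β) {l₁ l₂ : List β} (h : l₁.Perm l₂) :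
    ∀ P : List α, P.map f = l₁ → ∃ Q : List α, Q.Perm P ∧ Q.map f = l₂ := by
  induction h with
  | nil => exact fun P hP => ⟨P, .refl _, hP⟩
  | cons x _ ih =>
    intro P hP
    obtain ⟨a, P', rfl, rfl, hP'⟩ := List.map_eq_cons_iff.1 hP
    obtain ⟨Q, h1, h2⟩ := ih P' hP'
    exact ⟨a :: Q, h1.cons a, by simp [h2]⟩
  | swap x y l =>
    intro P hP
    obtain ⟨a, P₁, rfl, rfl, hP₁⟩ := List.map_eq_cons_iff.1 hP
    obtain ⟨b, P₂, rfl, rfl, hP₂⟩ := List.map_eq_cons_iff.1 hP₁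
    exact ⟨b :: a :: P₂, .swap _ _ _, by simp [hP₂]⟩
  | trans _ _ ih₁ ih₂ =>
    intro P hP
    obtain ⟨Q, h1, h2⟩ := ih₁ P hP
    obtain ⟨Q', h3, h4⟩ := ih₂ Q h2
    exact ⟨Q', h3.trans h1, h4⟩

/-- Passage from multisets to the indexed placements in the definition of `OPT`. -/
theorem FitsIn.OPT_le {L : List Rect} {H : ℝ} (h : FitsIn (L : Multiset Rect) 1 H) (hH : 0 ≤ H) :
    OPT L ≤ H := by
  obtain ⟨P, h1, h2, h3⟩ := h
  obtain ⟨Q, hQ, rfl⟩ := exists_perm_map_eq Prod.fst (Multiset.coe_eq_coe.1 h1) P rfl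
  have h3' : Q.Pairwise fun a b => Disjoint (a.1.openRegion a.2) (b.1.openRegion b.2) :=
    (hQ.pairwise_iff (fun h => h.symm)).2 h3
  have hl : (Q.map Prod.fst).length = Q.length := List.length_map _
  have hmem (i : Fin (Q.map Prod.fst).length) : Q[i.1] ∈ P := hQ.subset (List.getElem_mem _)
  refine csInf_le (feasibleHeights_bddBelow _) ⟨hH, fun i => (Q[i.1]).2, ?_⟩
  constructor
  · exact fun i => (h2 _ (hmem i)).1
  · intro i; simpa using (h2 _ (hmem i)).2.1
  · exact fun i => (h2 _ (hmem i)).2.2.1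
  · intro i; simpa using (h2 _ (hmem i)).2.2.2
  · intro i j hij
    have hij' : i.1 ≠ j.1 := fun h => hij (Fin.ext h)
    rw [List.pairwise_iff_getElem] at h3'
    rcases lt_or_gt_of_ne hij' with h | h
    · simpa using h3' i.1 j.1 (by omega) (by omega) h
    · simpa using (h3' j.1 i.1 (by omega) (by omega) h).symm

/-! ### Weighted heights -/

/-- The sum of the heights of the rectangles of `M`, each weighted by `f` of the width. -/
def weightedHeight (f : ℝ → ℝ) (M : Multiset Rect) : ℝ :=
  (M.map fun R => f R.width * R.height).sum

/-- The total area of the rectangles of `M`. -/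
abbrev area (M : Multiset Rect) : ℝ := weightedHeight (fun w => w) M

/-- The total height of the rectangles of `M` of width at least `w`. -/
abbrev tailHeight (M : Multiset Rect) (w : ℝ) : ℝ :=
  weightedHeight (fun v => if w ≤ v then 1 else 0) M

theorem weightedHeight_add (f : ℝ → ℝ) (M N : Multiset Rect) :
    weightedHeight f (M + N) = weightedHeight f M + weightedHeight f N := by
  simp [weightedHeight]

theorem weightedHeight_zero (f : ℝ → ℝ) : weightedHeight f 0 = 0 := by
  simp [weightedHeight]

theorem weightedHeight_cons (f : ℝ → ℝ) (R : Rect) (M : Multiset Rect) :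
    weightedHeight f (R ::ₘ M) = f R.width * R.height + weightedHeight f M := by
  simp [weightedHeight]

theorem weightedHeight_sum {ι : Type*} (f : ℝ → ℝ) (s : Finset ι) (M : ι → Multiset Rect) :
    weightedHeight f (∑ i ∈ s, M i) = ∑ i ∈ s, weightedHeight f (M i) := by
  classical
  induction s using Finset.induction_on with
  | empty => simp [weightedHeight_zero]
  | insert a s ha ih => rw [Finset.sum_insert ha, Finset.sum_insert ha, weightedHeight_add, ih]

theorem weightedHeight_mono {f g : ℝ → ℝ} {M : Multiset Rect}
    (h : ∀ R ∈ M, f R.width ≤ g R.width) : weightedHeight f M ≤ weightedHeight g M :=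
  Multiset.sum_map_le_sum_map _ _ fun R hR => mul_le_mul_of_nonneg_right (h R hR) R.height_pos.le

theorem weightedHeight_congr {f g : ℝ → ℝ} {M : Multiset Rect}
    (h : ∀ R ∈ M, f R.width = g R.width) : weightedHeight f M = weightedHeight g M :=
  (weightedHeight_mono fun R hR => (h R hR).le).antisymm
    (weightedHeight_mono fun R hR => (h R hR).ge)

theorem weightedHeight_nonneg {f : ℝ → ℝ} {M : Multiset Rect}
    (h : ∀ R ∈ M, 0 ≤ f R.width) : 0 ≤ weightedHeight f M := by
  have := weightedHeight_mono (f := fun _ => 0) h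
  simpa [weightedHeight] using this

theorem area_nonneg (M : Multiset Rect) : 0 ≤ area M :=
  weightedHeight_nonneg fun R _ => R.width_pos.le

/-! ### Greedy packing of shelves and columns -/

/-- Taking items one by one until their total size reaches `x` overshoots by at most the size of
one item. -/
theorem exists_append_sum_le {α : Type*} (f : α → ℝ) (c : ℝ) :
    ∀ (D : List α), (∀ R ∈ D, f R ≤ c) → ∀ x : ℝ, 0 ≤ x + c →
      ∃ D₁ D₂, D = D₁ ++ D₂ ∧ (D₁.map f).sum ≤ x + c ∧ (D₂ = [] ∨ x ≤ (D₁.map f).sum)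
  | [], _, x, hx => ⟨[], [], by simp, by simpa using hx, Or.inl rfl⟩
  | R :: D, hD, x, hx => by
    rcases le_or_gt x 0 with h0 | h0
    · exact ⟨[], R :: D, by simp, by simpa using hx, Or.inr (by simpa using h0)⟩
    · obtain ⟨D₁, D₂, h1, h2, h3⟩ := exists_append_sum_le f c D
        (fun S hS => hD S (by simp [hS])) (x - f R) (by linarith [hD R (by simp)])
      refine ⟨R :: D₁, D₂, by simp [h1], ?_, h3.imp id fun h => ?_⟩ <;>
        rw [List.map_cons, List.sum_cons] <;> linarith

theorem mul_sum_width_le_area {M : Multiset Rect} {c : ℝ} (h : ∀ R ∈ M, c ≤ R.height) :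
    c * (M.map Rect.width).sum ≤ area M := by
  rw [← Multiset.sum_map_mul_left]
  refine Multiset.sum_map_le_sum_map _ _ fun R hR => ?_
  rw [mul_comm]
  exact mul_le_mul_of_nonneg_left (h R hR) R.width_pos.le

/-- Next-fit decreasing height in one box: if rectangles are left over, every shelf is filled in
width up to a margin of `δ`, by rectangles at least as high as the next shelf. So the area in use is
at least `W - δ` times the total height of the shelves after the first one, including the one for
which there is no room; together with the first, of height at most `a`, they exceed `h`. -/
theorem exists_shelves {δ W : ℝ} (hW : δ < W) (hδ : 0 ≤ δ) (n : ℕ) :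
    ∀ (N : List Rect), N.length = n → N.Pairwise (fun R S => S.height ≤ R.height) →
      (∀ R ∈ N, R.width ≤ δ) → ∀ a h : ℝ, (∀ R ∈ N, R.height ≤ a) →
      ∃ P Q : List Rect, N = P ++ Q ∧ FitsIn P W h ∧ (Q = [] ∨ (W - δ) * (h - a) ≤ area P) := by
  induction n using Nat.strong_induction_on with
  | _ n ih =>
  intro N hn hs hw a h ha
  rcases N with _ | ⟨R, N⟩
  · exact ⟨[], [], rfl, fitsIn_zero _ _, Or.inl rfl⟩
  have hRa := ha R (by simp)
  rcases lt_or_ge h R.height with hh | hh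
  · refine ⟨[], R :: N, rfl, fitsIn_zero _ _, Or.inr ?_⟩
    rw [Multiset.coe_nil, area, weightedHeight_zero]
    exact mul_nonpos_of_nonneg_of_nonpos (by linarith) (by linarith)
  obtain ⟨D₁, D₂, hD, hle, hge⟩ := exists_append_sum_le Rect.width δ (R :: N) hw (W - δ)
    (by linarith)
  have hmem : ∀ S ∈ D₁, S ∈ R :: N := fun S hS => by rw [hD]; simp [hS]
  have hmem' : ∀ S ∈ D₂, S ∈ R :: N := fun S hS => by rw [hD]; simp [hS]
  have hR : ∀ S ∈ R :: N, S.height ≤ R.height := by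
    intro S hS
    rcases List.mem_cons.1 hS with rfl | hS
    · exact le_rfl
    · exact (List.pairwise_cons.1 hs).1 S hS
  have hfit : FitsIn D₁ W R.height :=
    (fitsIn_shelf (D₁ : Multiset Rect) fun S hS => hR S (hmem S hS)).mono
      (by simpa using hle) le_rfl
  rcases D₂ with _ | ⟨S, D₂⟩
  · rw [List.append_nil] at hD
    exact ⟨R :: N, [], by simp, hD ▸ hfit.mono le_rfl hh, Or.inl rfl⟩
  have hge : W - δ ≤ (D₁.map Rect.width).sum := hge.resolve_left (by simp)
  have hne : D₁ ≠ [] := by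
    rintro rfl
    simp at hge
    linarith
  have hs' := hD ▸ hs
  rw [List.pairwise_append] at hs'
  have hlen : (S :: D₂).length < n := by
    have := congrArg List.length hD
    have := List.length_pos_iff.2 hne
    simp only [List.length_append] at *
    omega
  obtain ⟨P, Q, hPQ, hP, hQ⟩ := ih _ hlen (S :: D₂) rfl hs'.2.1
    (fun T hT => hw T (hmem' T hT)) S.height (h - R.height) (fun T hT => by
      rcases List.mem_cons.1 hT with rfl | hT
      · exact le_rfl
      · exact (List.pairwise_cons.1 hs'.2.1).1 T hT)
  refine ⟨D₁ ++ P, Q, by rw [hD, hPQ, List.append_assoc], ?_, hQ.imp id fun hQ => ?_⟩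
  · rw [← Multiset.coe_add]
    convert hfit.stack hP R.height_pos.le (by linarith) using 1
    ring
  · rw [← Multiset.coe_add, area, weightedHeight_add]
    have h1 := mul_sum_width_le_area (M := (D₁ : Multiset Rect)) (c := S.height)
      fun T hT => hs'.2.2 T hT S (by simp)
    rw [Multiset.map_coe, Multiset.sum_coe] at h1
    have h2 := mul_le_mul_of_nonneg_left hge S.height_pos.le
    have h3 : (W - δ) * (R.height - a) ≤ 0 :=
      mul_nonpos_of_nonneg_of_nonpos (by linarith) (by linarith)
    unfold area at *
    nlinarith

/-- Next-fit decreasing height in several boxes: either everything is placed, or every box is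
filled up to a margin of `δ` in width and of one in height. -/
theorem exists_shelves_boxes {ι : Type*} {δ : ℝ} (hδ : 0 ≤ δ) (s : Finset ι) (W h : ι → ℝ)
    (hh : ∀ c ∈ s, 1 ≤ h c) (N : List Rect) (hs : N.Pairwise fun R S => S.height ≤ R.height)
    (hw : ∀ R ∈ N, R.width ≤ δ) :
    ∃ (M : ι → Multiset Rect) (Q : List Rect), Q <:+ N ∧
      (N : Multiset Rect) = ∑ c ∈ s, M c + Q ∧ (∀ c ∈ s, FitsIn (M c) (W c) (h c)) ∧
      (Q = [] ∨ ∀ c ∈ s, (W c - δ) * (h c - 1) ≤ area (M c)) := by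
  classical
  induction s using Finset.induction_on with
  | empty => exact ⟨fun _ => 0, N, List.suffix_refl _, by simp, by simp, by simp⟩
  | insert a s ha ih =>
    rw [Finset.forall_mem_insert] at hh
    obtain ⟨M, Q, h1, h2, h3, h4⟩ := ih hh.2
    have key : ∃ P Q' : List Rect, Q = P ++ Q' ∧ FitsIn P (W a) (h a) ∧
        (Q' = [] ∨ (W a - δ) * (h a - 1) ≤ area P) := by
      rcases lt_or_ge δ (W a) with hW | hW
      · exact exists_shelves hW hδ _ Q rfl (hs.sublist h1.sublist)
          (fun R hR => hw R (h1.subset hR)) 1 (h a) fun R _ => R.height_le_one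
      · exact ⟨[], Q, rfl, fitsIn_zero _ _, Or.inr
          ((mul_nonpos_of_nonpos_of_nonneg (by linarith) (by linarith [hh.1])).trans
            (area_nonneg _))⟩
    obtain ⟨P, Q', rfl, hP, hQ'⟩ := key
    have hne : ∀ c ∈ s, c ≠ a := fun c hc h => ha (h ▸ hc)
    refine ⟨Function.update M a P, Q', (List.suffix_append P Q').trans h1, ?_, ?_, ?_⟩
    · rw [Finset.sum_insert ha, Function.update_self, Finset.sum_congr rfl fun c hc =>
        Function.update_of_ne (hne c hc) _ _, h2, ← Multiset.coe_add]
      abel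
    · rw [Finset.forall_mem_insert, Function.update_self]
      refine ⟨hP, fun c hc => ?_⟩
      rw [Function.update_of_ne (hne c hc)]
      exact h3 c hc
    · rcases h4 with h4 | h4
      · exact Or.inl (List.append_eq_nil_iff.1 h4).2
      refine hQ'.imp id fun h => ?_
      rw [Finset.forall_mem_insert, Function.update_self]
      refine ⟨h, fun c hc => ?_⟩
      rw [Function.update_of_ne (hne c hc)]
      exact h4 c hc

/-- Filling columns greedily, wide rectangles into wide columns first. The hypothesis says that,
for every rectangle, the columns it fits into can take all rectangles at least as wide. -/
theorem exists_columns {κ : Type*} (s : Finset κ) (v x : κ → ℝ) :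
    (∀ k ∈ s, 0 ≤ x k) → ∀ D : List Rect, D.Pairwise (fun R S => S.width ≤ R.width) →
    (∀ R ∈ D, tailHeight D R.width ≤ ∑ k ∈ s, if R.width ≤ v k then x k else 0) →
    ∃ a : κ → Multiset Rect, (D : Multiset Rect) = ∑ k ∈ s, a k ∧
      ∀ k ∈ s, (∀ R ∈ a k, R.width ≤ v k) ∧ ((a k).map Rect.height).sum ≤ x k + 1 := by
  classical
  induction s using Finset.induction_on_max_value v with
  | empty =>
    intro _ D _ h
    rcases D with _ | ⟨R, D⟩
    · exact ⟨fun _ => 0, by simp, by simp⟩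
    · have h1 := h R (by simp)
      rw [tailHeight, ← Multiset.cons_coe, weightedHeight_cons] at h1
      have h2 : 0 ≤ weightedHeight (fun v => if R.width ≤ v then 1 else 0) D :=
        weightedHeight_nonneg fun S _ => by positivity
      simp at h1
      linarith [R.height_pos]
  | insert a s ha hmax ih =>
    intro hx D hs h
    rw [Finset.forall_mem_insert] at hx
    obtain ⟨D₁, D₂, rfl, hle, hge⟩ := exists_append_sum_le Rect.height 1 D
      (fun R _ => R.height_le_one) (x a) (by linarith [hx.1])
    have hwa : ∀ R ∈ D₁ ++ D₂, R.width ≤ v a := by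
      intro R hR
      by_contra! hlt
      have h1 := h R hR
      rw [Finset.sum_eq_zero] at h1
      · have h2 : 0 < tailHeight (D₁ ++ D₂ : List Rect) R.width := by
          obtain ⟨M, hM⟩ := Multiset.exists_cons_of_mem (Multiset.mem_coe.2 hR)
          rw [hM, tailHeight, weightedHeight_cons, if_pos le_rfl, one_mul]
          exact add_pos_of_pos_of_nonneg R.height_pos
            (weightedHeight_nonneg fun S _ => by positivity)
        linarith
      · intro k hk
        rw [if_neg]
        rcases Finset.mem_insert.1 hk with rfl | hk
        · exact not_le.2 hlt
        · exact not_le.2 ((hmax k hk).trans_lt hlt)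
    rw [List.pairwise_append] at hs
    obtain ⟨b, hb1, hb2⟩ := ih hx.2 D₂ hs.2.1 (by
      intro R hR
      have h1 := h R (by simp [hR])
      rw [Finset.sum_insert ha, if_pos (hwa R (by simp [hR])), ← Multiset.coe_add, tailHeight,
        weightedHeight_add] at h1
      have h2 : x a ≤ (D₁.map Rect.height).sum :=
        hge.resolve_left fun h0 => by simp [h0] at hR
      have h3 : weightedHeight (fun v => if R.width ≤ v then 1 else 0) D₁ =
          (D₁.map Rect.height).sum := by
        rw [weightedHeight_congr (g := fun _ => 1)
          fun S hS => if_pos (hs.2.2 S hS R hR)]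
        simp [weightedHeight]
      unfold tailHeight
      linarith)
    have hne : ∀ c ∈ s, c ≠ a := fun c hc h => ha (h ▸ hc)
    refine ⟨Function.update b a D₁, ?_, ?_⟩
    · rw [Finset.sum_insert ha, Function.update_self, Finset.sum_congr rfl fun c hc =>
        Function.update_of_ne (hne c hc) _ _, ← hb1, Multiset.coe_add]
    · rw [Finset.forall_mem_insert, Function.update_self]
      refine ⟨⟨fun R hR => hwa R (by simp at hR; simp [hR]), by simpa using hle⟩, fun c hc => ?_⟩
      rw [Function.update_of_ne (hne c hc)]
      exact hb2 c hc

/-! ### Fractional packings with few configurations -/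

open MeasureTheory in
/-- A horizontal line through a packing meets rectangles of total width at most one; averaging over
the line shows that the vector `∑ height • φ`, divided by the height of the packing, is a convex
combination of the vectors `∑ i ∈ S, φ i` of sets `S` of rectangles that fit side by side. -/
theorem IsPacking.average_mem_convexHull {L : List Rect} {H : ℝ} {pos : Fin L.length → ℝ × ℝ}
    (hp : IsPacking L H pos) (hH : 0 < H) {E : Type*} [NormedAddCommGroup E] [NormedSpace ℝ E]
    [FiniteDimensional ℝ E] (φ : Fin L.length → E) :
    H⁻¹ • ∑ i, (L.get i).height • φ i ∈ convexHull ℝ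
      ((fun S : Finset (Fin L.length) => ∑ i ∈ S, φ i) ''
        {S | ∑ i ∈ S, (L.get i).width ≤ 1}) := by
  classical
  have := FiniteDimensional.complete ℝ E
  set I : Fin L.length → Set ℝ := fun i => Set.Ioo (pos i).2 ((pos i).2 + (L.get i).height) with hI
  have hIH : ∀ i, I i ⊆ Set.Ioo 0 H := fun i => Set.Ioo_subset_Ioo (hp.bottom i) (hp.top i)
  have hint : ∀ i, IntegrableOn ((I i).indicator fun _ => φ i) (Set.Ioo 0 H) := fun i =>
    (integrable_const (φ i)).indicator measurableSet_Ioo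
  have havg : ⨍ y in Set.Ioo 0 H, ∑ i, (I i).indicator (fun _ => φ i) y =
      H⁻¹ • ∑ i, (L.get i).height • φ i := by
    rw [setAverage_eq, integral_finsetSum _ fun i _ => hint i]
    congr 1
    · simp [hH.le]
    · refine Finset.sum_congr rfl fun i _ => ?_
      rw [setIntegral_indicator measurableSet_Ioo, Set.inter_eq_right.2 (hIH i),
        setIntegral_const]
      rw [hI, Real.volume_real_Ioo_of_le (by linarith [(L.get i).height_pos]), add_sub_cancel_left]
  rw [← havg]
  refine (convex_convexHull ℝ _).set_average_mem
    ((Set.toFinite _).isClosed_convexHull ℝ) (by simp [hH]) (by simp) (ae_of_all _ fun y => ?_)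
    (integrable_finsetSum _ fun i _ => hint i)
  refine subset_convexHull ℝ _ ⟨Finset.univ.filter fun i => y ∈ I i, ?_, ?_⟩
  · set S : Finset (Fin L.length) := Finset.univ.filter fun i => y ∈ I i with hS
    set J : Fin L.length → Set ℝ :=
      fun i => Set.Ioo (pos i).1 ((pos i).1 + (L.get i).width) with hJ
    have hd : (S : Set (Fin L.length)).PairwiseDisjoint J := by
      intro i hi j hj hij
      refine Set.disjoint_left.2 fun z hz hz' => ?_
      have h := Set.disjoint_left.1 (hp.disjoint i j hij)
      exact @h (z, y) ⟨hz, (Finset.mem_filter.1 hi).2⟩ ⟨hz', (Finset.mem_filter.1 hj).2⟩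
    have h1 : volume.real (⋃ i ∈ S, J i) = ∑ i ∈ S, (L.get i).width := by
      rw [measureReal_biUnion_finset hd (fun i _ => measurableSet_Ioo)
        fun i _ => measure_Ioo_lt_top.ne]
      refine Finset.sum_congr rfl fun i _ => ?_
      rw [hJ, Real.volume_real_Ioo_of_le (by linarith [(L.get i).width_pos]), add_sub_cancel_left]
    have h2 : volume.real (⋃ i ∈ S, J i) ≤ volume.real (Set.Icc (0 : ℝ) 1) :=
      measureReal_mono (Set.iUnion₂_subset fun i _ => Set.Ioo_subset_Icc_self.trans
        (Set.Icc_subset_Icc (hp.left i) (hp.right i))) measure_Icc_lt_top.ne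
    rw [h1] at h2
    simpa using h2
  · simp only [Finset.sum_filter, Set.indicator_apply]

theorem weightedHeight_coe (f : ℝ → ℝ) (L : List Rect) :
    weightedHeight f L = ∑ i : Fin L.length, (L.get i).height * f (L.get i).width := by
  rw [weightedHeight, Multiset.map_coe, Multiset.sum_coe,
    ← Fin.sum_univ_fun_getElem L fun R => f R.width * R.height]
  exact Finset.sum_congr rfl fun i _ => mul_comm _ _

theorem IsPacking.area_le {L : List Rect} {H : ℝ} {pos : Fin L.length → ℝ × ℝ}
    (hp : IsPacking L H pos) (hH : 0 < H) : area L ≤ H := by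
  have h1 := hp.average_mem_convexHull hH fun i => (L.get i).width
  have h2 := convexHull_min (t := Set.Iic (1 : ℝ)) (by rintro _ ⟨S, hS, rfl⟩; exact hS)
    (convex_Iic 1) h1
  rw [Set.mem_Iic, smul_eq_mul, inv_mul_le_iff₀ hH, mul_one] at h2
  rw [area, weightedHeight_coe]
  exact h2

/-- By Carathéodory's theorem, `k` weighted heights of a packed list are those of a fractional
packing that uses at most `k + 1` configurations. -/
theorem IsPacking.exists_configurations {L : List Rect} {H : ℝ} {pos : Fin L.length → ℝ × ℝ}
    (hp : IsPacking L H pos) (hH : 0 < H) {J : Type} [Fintype J] (g : J → ℝ → ℝ) :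
    ∃ (ι : Type) (_ : Fintype ι) (l : ι → ℝ) (S : ι → Finset (Fin L.length)),
      Fintype.card ι ≤ Fintype.card J + 1 ∧ (∀ c, 0 < l c) ∧ ∑ c, l c = 1 ∧
      (∀ c, ∑ i ∈ S c, (L.get i).width ≤ 1) ∧
      ∀ j, H * ∑ c, l c * ∑ i ∈ S c, g j (L.get i).width = weightedHeight (g j) L := by
  obtain ⟨ι, hι, z, l, hz, hai, hl, hl1, hsum⟩ := eq_pos_convex_span_of_mem_convexHull
    (hp.average_mem_convexHull hH fun i => (fun j => g j (L.get i).width : J → ℝ))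
  choose S hS hSz using fun c => hz ⟨c, rfl⟩
  refine ⟨ι, hι, l, S, ?_, hl, hl1, hS, fun j => ?_⟩
  · refine (hai.card_le_finrank_succ).trans (Nat.succ_le_succ ?_)
    exact (Submodule.finrank_le _).trans (by simp)
  · have h1 := congrFun hsum j
    rw [Finset.sum_apply] at h1
    simp only [← hSz, Pi.smul_apply, Finset.sum_apply, smul_eq_mul] at h1
    rw [h1, weightedHeight_coe, mul_inv_cancel_left₀ hH.ne']

/-! ### Homogeneity and thresholds -/

/-- Grouping by width; `T` is any finite set that contains all widths of `L`. -/
theorem weightedHeight_eq_sum_heightOfWidth (f : ℝ → ℝ) (T : Finset ℝ) (L : List Rect)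
    (hT : ∀ R ∈ L, R.width ∈ T) :
    weightedHeight f L = ∑ w ∈ T, f w * heightOfWidth L w := by
  induction L with
  | nil => simp [weightedHeight, heightOfWidth]
  | cons R L ih =>
    have h (w : ℝ) : heightOfWidth (R :: L) w =
        (if R.width = w then R.height else 0) + heightOfWidth L w := by
      unfold heightOfWidth
      by_cases h : R.width = w <;> simp [h]
    rw [← Multiset.cons_coe, weightedHeight_cons, ih fun S hS => hT S (by simp [hS])]
    simp only [h, mul_add, Finset.sum_add_distrib, mul_ite, mul_zero]
    rw [Finset.sum_ite_eq, if_pos (hT R (by simp))]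

/-- Homogeneity compares every nonnegatively weighted height, not only the heights of a single
width. -/
theorem IsHomogenous.weightedHeight_le {r : ℝ} {L L' : List Rect} (h : IsHomogenous r L L')
    {f : ℝ → ℝ} (hf : ∀ w, 0 ≤ f w) : weightedHeight f L ≤ r * weightedHeight f L' := by
  classical
  have hT : ∀ R ∈ L ++ L', R.width ∈ ((L ++ L').map Rect.width).toFinset := fun R hR =>
    List.mem_toFinset.2 (List.mem_map_of_mem hR)
  rw [weightedHeight_eq_sum_heightOfWidth f _ L fun R hR => hT R (List.mem_append_left _ hR),
    weightedHeight_eq_sum_heightOfWidth f _ L' fun R hR => hT R (List.mem_append_right _ hR),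
    Finset.mul_sum]
  refine Finset.sum_le_sum fun w _ => ?_
  rw [mul_left_comm]
  exact mul_le_mul_of_nonneg_left (h.2 w).2 (hf w)

/-- Linear grouping: `m` thresholds approximate the function `tailHeight M` up to one `m`-th of the
total height. -/
theorem exists_thresholds (M : Multiset Rect) {δ : ℝ} (hM : ∀ R ∈ M, δ < R.width) {m : ℕ}
    (hm : 0 < m) :
    ∃ t : Fin m → ℝ, (∀ j, δ < t j) ∧ ∀ R ∈ M,
      tailHeight M R.width ≤ weightedHeight (fun _ => 1) M / m ∨
      ∃ j, R.width ≤ t j ∧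
        tailHeight M R.width ≤ tailHeight M (t j) + weightedHeight (fun _ => 1) M / m := by
  classical
  set A := weightedHeight (fun _ => 1) M with hA
  have hm' : (0 : ℝ) < m := by exact_mod_cast hm
  -- The `j`-th threshold is the largest width beyond which a height of `(j + 1) A / m` is left.
  have key : ∀ j : Fin m, ∃ t : ℝ, δ < t ∧ ∀ R ∈ M,
      ((j : ℕ) + 1 : ℝ) * (A / m) ≤ tailHeight M R.width →
        R.width ≤ t ∧ ((j : ℕ) + 1 : ℝ) * (A / m) ≤ tailHeight M t := by
    intro j
    set F := (M.map Rect.width).toFinset.filter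
      fun w => ((j : ℕ) + 1 : ℝ) * (A / m) ≤ tailHeight M w with hF
    have hmem : ∀ R ∈ M, ((j : ℕ) + 1 : ℝ) * (A / m) ≤ tailHeight M R.width → R.width ∈ F :=
      fun R hR h => Finset.mem_filter.2
        ⟨Multiset.mem_toFinset.2 (Multiset.mem_map_of_mem _ hR), h⟩
    rcases F.eq_empty_or_nonempty with h0 | h0
    · exact ⟨δ + 1, by linarith, fun R hR h => by simpa [h0] using hmem R hR h⟩
    · obtain ⟨h1, h2⟩ := Finset.mem_filter.1 (F.max'_mem h0)
      obtain ⟨S, hS, hSw⟩ := Multiset.mem_map.1 (Multiset.mem_toFinset.1 h1)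
      exact ⟨F.max' h0, hSw ▸ hM S hS, fun R hR h => ⟨F.le_max' _ (hmem R hR h), h2⟩⟩
  choose t ht1 ht2 using key
  refine ⟨t, ht1, fun R hR => ?_⟩
  have hle : tailHeight M R.width ≤ A :=
    weightedHeight_mono fun S _ => by split_ifs <;> norm_num
  rcases le_or_gt (tailHeight M R.width) (A / m) with h | h
  · exact Or.inl h
  right
  have hA0 : 0 < A := by
    refine lt_of_le_of_ne (weightedHeight_nonneg fun _ _ => zero_le_one) fun h0 => ?_
    rw [← h0, zero_div] at h
    linarith
  have hu : 0 < A / m := by positivity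
  set q := ⌊tailHeight M R.width / (A / m)⌋₊ with hq
  have hq1 : 1 ≤ q := Nat.le_floor (by rw [Nat.cast_one, le_div_iff₀ hu]; linarith)
  have hqm : q ≤ m := by
    refine Nat.floor_le_of_le ?_
    rw [div_le_iff₀ hu, mul_div_cancel₀ _ hm'.ne']
    exact hle
  have hq2 : (q : ℝ) * (A / m) ≤ tailHeight M R.width := by
    rw [← le_div_iff₀ hu]
    exact Nat.floor_le (div_nonneg (by linarith) hu.le)
  have hq3 : tailHeight M R.width < (q + 1) * (A / m) := by
    rw [← div_lt_iff₀ hu]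
    exact Nat.lt_floor_add_one _
  have hcast : (((q - 1 : ℕ) : ℝ) + 1) = q := by
    rw [Nat.cast_sub hq1]
    push_cast
    ring
  obtain ⟨h1, h2⟩ := ht2 ⟨q - 1, by omega⟩ R hR (by simpa only [hcast] using hq2)
  simp only [hcast] at h2
  exact ⟨_, h1, by linarith⟩

/-! ### Wide and narrow rectangles -/

theorem exists_sorted_perm (key : Rect → ℝ) (M : Multiset Rect) :
    ∃ D : List Rect, (D : Multiset Rect) = M ∧ D.Pairwise fun R S => key S ≤ key R := by
  classical
  induction M using Quotient.inductionOn with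
  | _ l =>
    let rel : Rect → Rect → Prop := fun R S => key S ≤ key R
    have : Std.Total rel := ⟨fun R S => le_total (key S) (key R)⟩
    have : IsTrans Rect rel := ⟨fun _ _ _ h1 h2 => le_trans h2 h1⟩
    exact ⟨l.insertionSort rel, Multiset.coe_eq_coe.2 (l.perm_insertionSort rel),
      l.pairwise_insertionSort rel⟩

/-- The rectangles of width greater than `δ`. -/
def wide (δ : ℝ) (M : Multiset Rect) : Multiset Rect :=
  open Classical in M.filter fun R => δ < R.width

/-- The rectangles of width at most `δ`. -/
def narrow (δ : ℝ) (M : Multiset Rect) : Multiset Rect :=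
  open Classical in M.filter fun R => ¬ δ < R.width

theorem wide_add_narrow (δ : ℝ) (M : Multiset Rect) : wide δ M + narrow δ M = M := by
  classical
  unfold wide narrow
  convert Multiset.filter_add_not (fun R : Rect => δ < R.width) M

theorem mem_wide {δ : ℝ} {M : Multiset Rect} {R : Rect} : R ∈ wide δ M ↔ R ∈ M ∧ δ < R.width := by
  simp [wide]

theorem mem_narrow {δ : ℝ} {M : Multiset Rect} {R : Rect} :
    R ∈ narrow δ M ↔ R ∈ M ∧ R.width ≤ δ := by
  simp [narrow]

theorem weightedHeight_wide (f : ℝ → ℝ) (δ : ℝ) (M : Multiset Rect) :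
    weightedHeight f (wide δ M) = weightedHeight (fun w => if δ < w then f w else 0) M := by
  conv_rhs => rw [← wide_add_narrow δ M, weightedHeight_add]
  rw [weightedHeight_congr (M := narrow δ M) (g := fun _ => 0)
      fun R hR => if_neg (not_lt.2 (mem_narrow.1 hR).2),
    weightedHeight_congr (M := wide δ M) (f := fun w => if δ < w then f w else 0) (g := f)
      fun R hR => if_pos (mem_wide.1 hR).2]
  simp [weightedHeight]

theorem weightedHeight_narrow (f : ℝ → ℝ) (δ : ℝ) (M : Multiset Rect) :
    weightedHeight f (narrow δ M) = weightedHeight (fun w => if δ < w then 0 else f w) M := by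
  conv_rhs => rw [← wide_add_narrow δ M, weightedHeight_add]
  rw [weightedHeight_congr (M := narrow δ M) (f := fun w => if δ < w then 0 else f w) (g := f)
      fun R hR => if_neg (not_lt.2 (mem_narrow.1 hR).2),
    weightedHeight_congr (M := wide δ M) (g := fun _ => 0)
      fun R hR => if_pos (mem_wide.1 hR).2]
  simp [weightedHeight]

/-- Narrow rectangles do not count towards the tail at a threshold beyond `δ`. -/
theorem tailHeight_wide {δ t : ℝ} (ht : δ < t) (M : Multiset Rect) :
    tailHeight (wide δ M) t = tailHeight M t := by
  rw [tailHeight, weightedHeight_wide]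
  refine weightedHeight_congr fun R _ => ?_
  split_ifs with h1 h2 h2
  · rfl
  · rfl
  · exact absurd (ht.trans_le h2) h1
  · rfl

theorem IsHomogenous.wide_weightedHeight_le {r : ℝ} {L L' : List Rect} (h : IsHomogenous r L L')
    {f : ℝ → ℝ} (hf : ∀ w, 0 ≤ f w) (δ : ℝ) :
    weightedHeight f (wide δ L) ≤ r * weightedHeight f (wide δ L') := by
  rw [weightedHeight_wide, weightedHeight_wide]
  exact h.weightedHeight_le fun w => by split_ifs; exacts [hf w, le_rfl]

theorem area_narrow_le {r : ℝ} {L L' : List Rect} (h : IsHomogenous r L L') {δ : ℝ} :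
    area (narrow δ L) ≤ r * area (narrow δ L') := by
  -- The weight `max w 0` agrees with `w` on the width of every rectangle.
  have key (M : Multiset Rect) :
      area (narrow δ M) = weightedHeight (fun w => if δ < w then 0 else max w 0) M := by
    rw [area, weightedHeight_narrow]
    exact weightedHeight_congr fun R _ => by rw [max_eq_left R.width_pos.le]
  rw [key, key]
  exact h.weightedHeight_le fun w => by split_ifs; exacts [le_rfl, le_max_right _ _]

theorem mul_height_wide_le_area {δ : ℝ} (M : Multiset Rect) :
    δ * weightedHeight (fun _ => 1) (wide δ M) ≤ area (wide δ M) := by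
  rw [weightedHeight, ← Multiset.sum_map_mul_left]
  refine Multiset.sum_map_le_sum_map _ _ fun R hR => ?_
  rw [one_mul]
  exact mul_le_mul_of_nonneg_right (mem_wide.1 hR).2.le R.height_pos.le

/-! ### The packing -/

/-- The Kenyon–Rémila packing: given a packing of `L'`, the wide rectangles of `L` go into the
columns of few configurations, the narrow ones into the space beside the columns and on top. -/
theorem IsHomogenous.OPT_le {r : ℝ} {L L' : List Rect} (h : IsHomogenous r L L') {H : ℝ}
    {pos : Fin L'.length → ℝ × ℝ} (hp : IsPacking L' H pos) (hH : 0 < H) {δ : ℝ} (hδ : 0 < δ)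
    (hδ1 : δ < 1) {m : ℕ} (hm : 0 < m) :
    OPT L ≤ r * H + r * H / δ / m + δ * (r * H) / (1 - δ) + m + 4 := by
  classical
  have hr : 0 < r := one_pos.trans_le h.1
  have hm' : (0 : ℝ) < m := by exact_mod_cast hm
  obtain ⟨D, hD, hDs⟩ := exists_sorted_perm Rect.width (wide δ L)
  obtain ⟨N, hN, hNs⟩ := exists_sorted_perm Rect.height (narrow δ L)
  set A := weightedHeight (fun _ => 1) (wide δ L) with hA
  have hA0 : 0 ≤ A := weightedHeight_nonneg fun _ _ => zero_le_one
  have hAle : A ≤ r * H / δ := by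
    have h1 := h.wide_weightedHeight_le (f := fun _ => 1) (fun _ => zero_le_one) δ
    have h2 := mul_height_wide_le_area (δ := δ) (L' : Multiset Rect)
    have h3 : area (wide δ L') + area (narrow δ L') ≤ H := by
      rw [area, area, ← weightedHeight_add, wide_add_narrow]
      exact hp.area_le hH
    have h4 := area_nonneg (narrow δ L')
    rw [le_div_iff₀ hδ]
    calc A * δ ≤ r * weightedHeight (fun _ => 1) (wide δ L') * δ :=
          mul_le_mul_of_nonneg_right h1 hδ.le
      _ = r * (δ * weightedHeight (fun _ => 1) (wide δ L')) := by ring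
      _ ≤ r * H := mul_le_mul_of_nonneg_left (by linarith) hr.le
  -- The functionals to preserve: the tail heights at the `m` thresholds, and the wide area.
  obtain ⟨t, htδ, ht⟩ := exists_thresholds (wide δ L) (fun R hR => (mem_wide.1 hR).2) hm
  rw [← hA] at ht
  obtain ⟨ι, _, l, S, hcard, hl, hl1, hS, hg⟩ := hp.exists_configurations hH
    (fun (j : Option (Fin m)) w => j.elim (if δ < w then w else 0) fun j => if t j ≤ w then 1 else 0)
  have hcard' : (Fintype.card ι : ℝ) ≤ m + 2 := by
    rw [Fintype.card_option, Fintype.card_fin] at hcard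
    exact_mod_cast hcard
  have hgA := hg none
  have hgt := fun j => hg (some j)
  simp only [Option.elim_none, Option.elim_some] at hgA hgt
  rw [← weightedHeight_wide (fun w => w)] at hgA
  clear hg
  -- The wide members of a configuration are its columns; one more column has width one.
  set K : ι → Finset (Fin L'.length) := fun c => (S c).filter fun i => δ < (L'.get i).width with hK
  set x : ι → ℝ := fun c => r * H * l c with hx
  have hx0 : ∀ c, 0 ≤ x c := fun c => by have := hl c; positivity
  have hxsum : ∑ c, x c = r * H := by rw [hx, ← Finset.mul_sum, hl1, mul_one]
  set s : Finset (Option (Σ _ : ι, Fin L'.length)) :=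
    Finset.insertNone (Finset.univ.sigma K) with hs
  set X : Option (Σ _ : ι, Fin L'.length) → ℝ := fun k => k.elim (A / m) fun k => x k.1 with hX
  set V : Option (Σ _ : ι, Fin L'.length) → ℝ :=
    fun k => k.elim 1 fun k => (L'.get k.2).width with hV
  obtain ⟨a, ha, haK⟩ := exists_columns s V X
    (by rintro (_ | k) _; exacts [div_nonneg hA0 hm'.le, hx0 _]) D hDs (by
      intro R hR
      rw [← Multiset.mem_coe, hD] at hR
      rw [hD, hs, Finset.sum_insertNone, Finset.sum_sigma]
      simp only [hX, hV, Option.elim_none, Option.elim_some]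
      rw [if_pos R.width_le_one]
      rcases ht R hR with h1 | ⟨j, h1, h2⟩
      -- Few rectangles are at least this wide: the extra column of width one takes them all.
      · refine h1.trans (le_add_of_nonneg_right (Finset.sum_nonneg fun c _ =>
          Finset.sum_nonneg fun i _ => ?_))
        split_ifs
        exacts [hx0 c, le_rfl]
      -- Otherwise the configurations have, at the threshold `t j`, columns for all rectangles of
      -- width at least `t j`, and the extra column makes up for the widths below the threshold.
      · rw [add_comm] at h2
        refine h2.trans (add_le_add_right ?_ _)
        rw [tailHeight_wide (htδ j)]
        refine (h.weightedHeight_le fun w => by split_ifs <;> norm_num).trans ?_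
        rw [← hgt j, ← mul_assoc, Finset.mul_sum]
        refine Finset.sum_le_sum fun c _ => ?_
        rw [← mul_assoc, Finset.mul_sum, hK, Finset.sum_filter]
        refine Finset.sum_le_sum fun i _ => ?_
        have := hx0 c
        by_cases h3 : t j ≤ (L'.get i).width
        · rw [if_pos h3, if_pos ((htδ j).trans_le h3), if_pos (h1.trans h3), mul_one]
        · rw [if_neg h3, mul_zero]
          split_ifs <;> first | exact this | exact le_rfl)
  rw [hD, hs, Finset.sum_insertNone, Finset.sum_sigma] at ha
  set U : ι → ℝ := fun c => ∑ i ∈ K c, (L'.get i).width with hU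
  have hU1 : ∀ c, U c ≤ 1 := fun c =>
    (Finset.sum_le_sum_of_subset_of_nonneg (Finset.filter_subset _ _)
      fun i _ _ => (L'.get i).width_pos.le).trans (hS c)
  have hUarea : ∑ c, x c * U c = r * area (wide δ L') := by
    rw [area, ← hgA, ← mul_assoc, Finset.mul_sum]
    refine Finset.sum_congr rfl fun c _ => ?_
    have h1 : U c = ∑ i ∈ S c, if δ < (L'.get i).width then (L'.get i).width else 0 :=
      Finset.sum_filter _ _
    rw [h1, ← mul_assoc]
  obtain ⟨M, Q, hQN, hNM, hMfit, hQ⟩ := exists_shelves_boxes hδ.le Finset.univ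
    (fun c => 1 - U c) (fun c => x c + 1) (fun c _ => by linarith [hx0 c]) N hNs
    (fun R hR => (mem_narrow.1 (hN ▸ Multiset.mem_coe.2 hR)).2)
  -- The boxes beside the columns and the wide area of `r` copies of `L'` add up to `r * H`, so
  -- full boxes leave only their margins, of area `δ * (r * H)`, to the remainder.
  have hQarea : area Q ≤ δ * (r * H) := by
    rcases hQ with rfl | hQ
    · rw [Multiset.coe_nil, area, weightedHeight_zero]
      positivity
    have h1 : area (narrow δ L) = ∑ c, area (M c) + area Q := by
      rw [← hN, hNM, area, weightedHeight_add, weightedHeight_sum]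
    have h2 : ∑ c, (x c - x c * U c - δ * x c) ≤ ∑ c, area (M c) :=
      Finset.sum_le_sum fun c hc => by
        refine le_trans (le_of_eq ?_) (hQ c hc)
        ring
    rw [Finset.sum_sub_distrib, Finset.sum_sub_distrib, ← Finset.mul_sum Finset.univ x, hUarea,
      hxsum] at h2
    have h3 := area_narrow_le h (δ := δ)
    have h4 : r * (area (wide δ L') + area (narrow δ L')) ≤ r * H := by
      refine mul_le_mul_of_nonneg_left ?_ hr.le
      rw [area, area, ← weightedHeight_add, wide_add_narrow]
      exact hp.area_le hH
    linarith
  -- A box that could not hold the remainder would contain at least its whole area.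
  have hQfit : FitsIn Q 1 (δ * (r * H) / (1 - δ) + 1) := by
    obtain ⟨P, Q', hPQ, hP, hQ'⟩ := exists_shelves hδ1 hδ.le _ Q rfl
      (hNs.sublist hQN.sublist)
      (fun R hR => (mem_narrow.1 (hN ▸ Multiset.mem_coe.2 (hQN.subset hR))).2) 1
      (δ * (r * H) / (1 - δ) + 1) fun R _ => R.height_le_one
    rcases Q' with _ | ⟨R, Q'⟩
    · rw [hPQ, List.append_nil]
      exact hP
    · exfalso
      have h1 := hQ'.resolve_left (by simp)
      rw [add_sub_cancel_right, mul_div_cancel₀ _ (by linarith : (1 : ℝ) - δ ≠ 0)] at h1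
      rw [hPQ, ← Multiset.coe_add, area, weightedHeight_add, ← Multiset.cons_coe,
        weightedHeight_cons] at hQarea
      have h2 : 0 < R.width * R.height := mul_pos R.width_pos R.height_pos
      have h3 := area_nonneg (Q' : Multiset Rect)
      unfold area at h1 h3
      linarith
  have hnone : FitsIn (a none) 1 (A / m + 1) := by
    obtain ⟨h1, h2⟩ := haK none (by simp [hs])
    exact (fitsIn_column _ h1).mono le_rfl h2
  have hconf : ∀ c ∈ Finset.univ,
      FitsIn (∑ i ∈ K c, a (some ⟨c, i⟩) + M c) 1 (x c + 1) := by
    intro c hc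
    have hx1 : 0 ≤ x c + 1 := by linarith [hx0 c]
    have h1 : FitsIn (∑ i ∈ K c, a (some ⟨c, i⟩)) (U c) (x c + 1) := by
      refine fitsIn_sum_beside _ _ _ _ (fun i _ => (L'.get i).width_pos.le) fun i hi => ?_
      obtain ⟨h1, h2⟩ := haK (some ⟨c, i⟩) (by simp [hs, hi])
      exact (fitsIn_column _ h1).mono le_rfl h2
    have h2 := h1.beside (hMfit c hc)
      (Finset.sum_nonneg fun i _ => (L'.get i).width_pos.le) (by linarith [hU1 c])
    rwa [add_sub_cancel] at h2
  have hall := (hnone.stack (fitsIn_sum_stack _ _ _ _ (fun c _ => by linarith [hx0 c]) hconf)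
    (by positivity) (Finset.sum_nonneg fun c _ => by linarith [hx0 c])).stack hQfit
    (add_nonneg (by positivity) (Finset.sum_nonneg fun c _ => by linarith [hx0 c]))
    (add_nonneg (div_nonneg (by positivity) (by linarith)) zero_le_one)
  have hsum : a none + ∑ c, (∑ i ∈ K c, a (some ⟨c, i⟩) + M c) + Q = (L : Multiset Rect) := by
    rw [← wide_add_narrow δ (L : Multiset Rect), ha, ← hN, hNM, Finset.sum_add_distrib]
    abel
  rw [hsum] at hall
  have hdiv : 0 ≤ δ * (r * H) / (1 - δ) := div_nonneg (by positivity) (by linarith)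
  have hAm : A / m ≤ r * H / δ / m := div_le_div_of_nonneg_right hAle hm'.le
  have hle : A / m + 1 + ∑ c, (x c + 1) + (δ * (r * H) / (1 - δ) + 1) ≤
      r * H + r * H / δ / m + δ * (r * H) / (1 - δ) + m + 4 := by
    rw [Finset.sum_add_distrib, hxsum]
    simp only [Finset.sum_const, Finset.card_univ, nsmul_eq_mul, mul_one]
    linarith
  exact (hall.mono le_rfl hle).OPT_le (by positivity)

theorem IsPacking.mono {L : List Rect} {H H' : ℝ} {pos : Fin L.length → ℝ × ℝ}
    (h : IsPacking L H pos) (hH : H ≤ H') : IsPacking L H' pos :=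
  ⟨h.left, h.right, h.bottom, fun i => (h.top i).trans hH, h.disjoint⟩

end StripPacking

end

theorem theorem1 :
    ∃ C : ℝ, ∀ (L L' : List StripPacking.Rect) (r : ℝ), StripPacking.IsHomogenous r L L' →
      ∀ ε : ℝ, 0 < ε →
        StripPacking.OPT L ≤ r * (1 + ε) * StripPacking.OPT L' + C * max 1 (1 / ε ^ 2) := by
  refine ⟨21, fun L L' r h ε hε => ?_⟩
  have hr : 0 < r := one_pos.trans_le h.1
  have hO : 0 ≤ StripPacking.OPT L' := Real.sInf_nonneg fun _ h => h.1
  set B : ℝ := max 1 (1 / ε ^ 2) with hB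
  have hB1 : 1 ≤ B := le_max_left _ _
  set δ : ℝ := min 1 ε / 4 with hδ
  have hδ0 : 0 < δ := by positivity
  have hδ1 : δ ≤ 1 / 4 := by have := min_le_left 1 ε; linarith
  have hδε : 4 * δ ≤ ε := by have := min_le_right 1 ε; linarith
  have hδB : 1 / δ ^ 2 ≤ 16 * B := by
    rcases le_total 1 ε with h1 | h1
    · rw [hδ, min_eq_left h1]
      norm_num
      linarith
    · have h2 : 1 / ε ^ 2 ≤ B := le_max_right _ _
      rw [hδ, min_eq_right h1]
      calc 1 / (ε / 4) ^ 2 = 16 * (1 / ε ^ 2) := by field_simp; norm_num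
        _ ≤ 16 * B := by linarith
  set m := ⌈1 / δ ^ 2⌉₊ with hm
  have hm1 : 1 / δ ^ 2 ≤ m := Nat.le_ceil _
  have hm2 : (m : ℝ) < 1 / δ ^ 2 + 1 := Nat.ceil_lt_add_one (by positivity)
  have hm0 : 0 < m := Nat.ceil_pos.2 (by positivity)
  have hm0' : (0 : ℝ) < m := by exact_mod_cast hm0
  have key : ∀ H, StripPacking.OPT L' < H →
      StripPacking.OPT L ≤ r * (1 + ε) * H + 21 * B := by
    intro H hOH
    obtain ⟨H₀, ⟨-, pos, hp⟩, hlt⟩ := exists_lt_of_csInf_lt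
      (StripPacking.feasibleHeights_nonempty L') hOH
    have hH : 0 < H := hO.trans_lt hOH
    have h1 := h.OPT_le (hp.mono hlt.le) hH hδ0 (by linarith) hm0
    have h2 : r * H / δ / m ≤ δ * (r * H) := by
      rw [div_div, div_le_iff₀ (by positivity)]
      have h3 : 1 ≤ m * δ ^ 2 := (div_le_iff₀ (by positivity)).1 hm1
      calc r * H = r * H * 1 := (mul_one _).symm
        _ ≤ r * H * (m * δ ^ 2) := mul_le_mul_of_nonneg_left h3 (by positivity)
        _ = δ * (r * H) * (δ * m) := by ring
    have h3 : δ * (r * H) / (1 - δ) ≤ 2 * (δ * (r * H)) := by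
      rw [div_le_iff₀ (by linarith)]
      have : 0 < δ * (r * H) := by positivity
      nlinarith
    have h4 : 4 * δ * (r * H) ≤ ε * (r * H) :=
      mul_le_mul_of_nonneg_right hδε (by positivity)
    have h5 : 0 < δ * (r * H) := by positivity
    linarith
  -- Let `H` tend to `OPT L'`; strict inequality keeps `H` positive even when `OPT L' = 0`.
  refine le_of_forall_pos_le_add fun η hη => ?_
  have h1 := key (StripPacking.OPT L' + η / (r * (1 + ε))) (by
    have : 0 < η / (r * (1 + ε)) := by positivity
    linarith)
  rw [mul_add, mul_div_cancel₀ _ (by positivity)] at h1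
  linarith
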